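/- **Setting.** An instance consists of a finite (multi)graph $G=(V,E)$ and, for each edge $e\in E$, an uncertainty interval $I_e\subseteq\mathbb R_{\ge 0}$ that is either open, $I_e=(L_e,U_e)$ with $L_e<U_e$ (non-trivial edge), or a singleton, $I_e=\{L_e\}$ with $U_e=L_e$ (trivial edge), together with a predicted weight $\overline w_e\in I_e$. The true weights $w_e\in I_e$ are unknown; a query of $e$ reveals $w_e$. A set $Q\subseteq E$ is a *feasible query set* for the true weights $w$ if some fixed $T\subseteq E$ is a minimum spanning tree (MST) of $G$ for every weight vector $w'$ with $w'_e=w_e$ for $e\in Q$ and $w'_e\in I_e$ for $e\in E\setminus Q$; $\mathrm{OPT}$ denotes a feasible query set of minimum cardinality. The instance is *prediction mandatory free* if no edge belongs to every feasible query set for the true weights $w=\overline w$. A *lower limit tree* is an MST for the weights $L_e+\varepsilon$ on non-trivial edges, with infinitesimally small $\varepsilon>0$ (that is, for all sufficiently small $\varepsilon>0$), and $L_e$ on trivial edges; an *upper limit tree* is an MST for the weights $U_e-\varepsilon$ on non-trivial edges, again for all sufficiently small $\varepsilon>0$, and $U_e$ on trivial edges. The instance has *unique $T_L=T_U$* if it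 has exactly one lower limit tree $T_L$ and exactly one upper limit tree $T_U$, and $T_L=T_U$. A (deterministic) algorithm receives the graph, the intervals and the predictions and queries edges one after another, where each decision may depend on the weights revealed so far; it must terminate, and the edges that it has queried must form a feasible query set and prove that the edge set that it returns is an MST. **Theorem.** There is a deterministic algorithm with the following two properties on every prediction mandatory free instance with unique $T_L=T_U$. 1. ($1$-consistency) If the predictions are correct, that is, $w=\overline w$, it executes at most $|\mathrm{OPT}|$ queries. 2. ($2$-robustness) For all true weights $w_e\in I_e$, $e\in E$, whatever the predictions, it executes at most $2\cdot|\mathrm{OPT}|$ queries. -/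

import Mathlib

universe u v

open Classical in
/-- The uncertainty interval with limits `a ≤ b`: the singleton `{a}` if `a = b`, and the open
interval `(a, b)` if `a < b`. -/
noncomputable def uncertaintyInterval (a b : ℝ) : Set ℝ := if a = b then {a} else Set.Ioo a b

/-- An instance of the minimum spanning tree problem under explorable uncertainty with predictions:
a multigraph on the vertex type `V` with edges indexed by `E` (parallel edges and loops are
allowed), and for every edge the limits of its uncertainty interval and a predicted weight in that
interval. -/
structure MSTInstance (V : Type u) (E : Type v) where
  ends : E → Sym2 V
  lo : E → ℝ
  hi : E → ℝ
  pred : E → ℝ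
  lo_nonneg : ∀ e, 0 ≤ lo e
  lo_le_hi : ∀ e, lo e ≤ hi e
  pred_mem : ∀ e, pred e ∈ uncertaintyInterval (lo e) (hi e)

namespace MSTInstance

variable {V : Type u} {E : Type v} (I : MSTInstance V E)

/-- The uncertainty interval of an edge. -/
noncomputable def interval (e : E) : Set ℝ := uncertaintyInterval (I.lo e) (I.hi e)

/-- A trivial edge: its uncertainty interval is a singleton, so its weight is known. -/
def Trivial (e : E) : Prop := I.lo e = I.hi e

/-- `w` is a possible assignment of true edge weights. -/
def IsRealization (w : E → ℝ) : Prop := ∀ e, w e ∈ I.interval e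

/-- `T` is the edge set of a spanning tree: it contains no loop and no two parallel edges, and the
simple graph on all of `V` formed by its edges is a tree. -/
def IsSpanningTree (T : Finset E) : Prop :=
  (∀ e ∈ T, ¬ (I.ends e).IsDiag) ∧ Set.InjOn I.ends (T : Set E) ∧
    (SimpleGraph.fromEdgeSet (I.ends '' (T : Set E))).IsTree

/-- `T` is a minimum spanning tree for the edge weights `w`. -/
def IsMST (w : E → ℝ) (T : Finset E) : Prop :=
  I.IsSpanningTree T ∧ ∀ T' : Finset E, I.IsSpanningTree T' → ∑ e ∈ T, w e ≤ ∑ e ∈ T', w e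

/-- When the true weights are `w`, querying the edges of `Q` proves that `T` is a minimum spanning
tree: `T` is one for the revealed weights on `Q` and every possible combination of weights of the
unqueried edges. -/
def Certifies (w : E → ℝ) (Q T : Finset E) : Prop :=
  ∀ w' : E → ℝ, I.IsRealization w' → (∀ e ∈ Q, w' e = w e) → I.IsMST w' T

/-- `Q` is a feasible query set for the true weights `w`. -/
def IsFeasible (w : E → ℝ) (Q : Finset E) : Prop := ∃ T : Finset E, I.Certifies w Q T

/-- `Q` is an optimal query set for the true weights `w`: feasible of minimum cardinality. -/
def IsOptimal (w : E → ℝ) (Q : Finset E) : Prop :=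
  I.IsFeasible w Q ∧ ∀ Q' : Finset E, I.IsFeasible w Q' → Q.card ≤ Q'.card

/-- `e` is mandatory for the true weights `w`: it belongs to every feasible query set. -/
def IsMandatory (w : E → ℝ) (e : E) : Prop := ∀ Q : Finset E, I.IsFeasible w Q → e ∈ Q

/-- No edge is mandatory under the assumption that the predictions are correct. -/
def PredictionMandatoryFree : Prop := ∀ e, ¬ I.IsMandatory I.pred e

open Classical in
/-- The weights `w^L`: non-trivial edges have weights `ε` above their lower limits, trivial edges
have their known weights. -/
noncomputable def lowerWeight (ε : ℝ) (e : E) : ℝ := if I.Trivial e then I.lo e else I.lo e + ε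

open Classical in
/-- The weights `w^U`: non-trivial edges have weights `ε` below their upper limits, trivial edges
have their known weights. -/
noncomputable def upperWeight (ε : ℝ) (e : E) : ℝ := if I.Trivial e then I.hi e else I.hi e - ε

/-- `T` is a lower limit tree: a minimum spanning tree for `w^L` with infinitesimally small `ε`,
that is, for all sufficiently small `ε > 0`. -/
def IsLowerLimitTree (T : Finset E) : Prop :=
  ∃ ε₀ : ℝ, 0 < ε₀ ∧ ∀ ε : ℝ, 0 < ε → ε < ε₀ → I.IsMST (I.lowerWeight ε) T

/-- `T` is an upper limit tree: a minimum spanning tree for `w^U` with infinitesimally small `ε`,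
that is, for all sufficiently small `ε > 0`. -/
def IsUpperLimitTree (T : Finset E) : Prop :=
  ∃ ε₀ : ℝ, 0 < ε₀ ∧ ∀ ε : ℝ, 0 < ε → ε < ε₀ → I.IsMST (I.upperWeight ε) T

/-- The instance has unique `T_L = T_U`: there is exactly one lower limit tree and exactly one upper
limit tree, and they coincide. -/
def UniqueLimitTrees : Prop :=
  ∃ T : Finset E, (I.IsLowerLimitTree T ∧ ∀ T', I.IsLowerLimitTree T' → T' = T) ∧
    (I.IsUpperLimitTree T ∧ ∀ T', I.IsUpperLimitTree T' → T' = T)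

end MSTInstance

/-- A deterministic adaptive query strategy: terminate and return an edge set, or query an edge and
continue depending on the revealed weight. Every run of a strategy is finite. -/
inductive QueryStrategy (E : Type v) : Type v
  | output (T : Finset E) : QueryStrategy E
  | query (e : E) (next : ℝ → QueryStrategy E) : QueryStrategy E

namespace QueryStrategy

variable {V : Type u} {E : Type v}

/-- The sequence of queries executed when the true weights are `w`. -/
def queries : QueryStrategy E → (E → ℝ) → List E
  | output _, _ => []
  | query e next, w => e :: (next (w e)).queries w

/-- The edge set returned when the true weights are `w`. -/
def result : QueryStrategy E → (E → ℝ) → Finset E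
  | output T, _ => T
  | query e next, w => (next (w e)).result w

open Classical in
/-- The strategy is `ρ`-competitive on instance `I` with true weights `w`: its queries prove that the
returned edge set is a minimum spanning tree (so they form a feasible query set), and it executes at
most `ρ * |OPT|` queries, where a repeated query counts again. -/
def IsCompetitive (S : QueryStrategy E) (I : MSTInstance V E) (w : E → ℝ) (ρ : ℝ) : Prop :=
  I.Certifies w (S.queries w).toFinset (S.result w) ∧
    ∀ OPT : Finset E, I.IsOptimal w OPT → ((S.queries w).length : ℝ) ≤ ρ * (OPT.card : ℝ)

/-- `α`-competitive when the predictions are correct. -/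
def IsConsistent (S : QueryStrategy E) (I : MSTInstance V E) (α : ℝ) : Prop :=
  S.IsCompetitive I I.pred α

/-- `β`-competitive no matter what the true weights are. -/
def IsRobust (S : QueryStrategy E) (I : MSTInstance V E) (β : ℝ) : Prop :=
  ∀ w : E → ℝ, I.IsRealization w → S.IsCompetitive I w β

end QueryStrategy

/-- A deterministic algorithm: it receives a finite instance (the multigraph, the uncertainty
intervals and the predictions, but not the true weights) and runs an adaptive query strategy. -/
def QueryAlgorithm : Type (max (u + 1) (v + 1)) :=
  ∀ (V : Type u) (E : Type v) [Finite V] [Finite E], MSTInstance V E → QueryStrategy E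

/-! Let `T` be the common limit tree. Join a tree edge `e` to a non-tree edge `f` when `e` lies on
the cycle that `f` closes and their intervals overlap. This graph is bipartite, so by König's
theorem a minimum vertex cover `C` is matched injectively into its complement by some `p`
(`Finset.exists_matched_vertexCover`).

Upper bound: all other exchange pairs are already ordered by their intervals, so if every weight in
`C` confirms `T`, querying `C` is enough. Without prediction mandatory edges, correct predictions
confirm `T` (`PredictionMandatoryFree.confirms_pred`).

Lower bound: if a feasible set avoids both ends of an overlapping pair, an edge more extreme than
one end and on the same side of `T` must beat that end (`LowerOptimal.exists_hi_le_weight` and its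
dual). For a pair `x`, `p x` this edge lies in `C` and precedes `x` in the query order; had it
confirmed `T`, that would be a contradiction. So as long as the earlier cover edges confirm `T`,
each pair meets every feasible set, and the pairs are disjoint. With correct predictions this gives
`C.card ≤ |OPT|`.

Robustness: at the first cover edge that fails to confirm `T`, the partners of all cover edges
queried so far are queried too. These complete pairs cost at most twice what any feasible set spends
on them, and the rest is solved by repeatedly querying pairs that every feasible set must meet
(`exists_robust_continuation`). -/

namespace SimpleGraph

/-! ### Connectivity and cuts. -/

variable {V : Type u} {G H : SimpleGraph V}

lemma Connected.of_adj_reachable (hG : G.Connected) (h : ∀ a b, G.Adj a b → H.Reachable a b) :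
    H.Connected := by
  have := hG.nonempty
  refine ⟨fun a b => ?_⟩
  obtain ⟨p⟩ := hG.preconnected a b
  induction p with
  | nil => exact .rfl
  | cons hadj _ ih => exact (h _ _ hadj).trans ih

/-- A path leaving the set of vertices satisfying `P` does so along an edge whose removal leaves the
rest of the path intact. -/
lemma Walk.IsPath.exists_crossing_adj {P : V → Prop} {a b : V} {p : G.Walk a b} (hp : p.IsPath)
    (ha : P a) (hb : ¬ P b) :
    ∃ x y, x ∈ p.support ∧ y ∈ p.support ∧ G.Adj x y ∧ P x ∧ ¬ P y ∧
      (G.deleteEdges {s(x, y)}).Reachable a x ∧ (G.deleteEdges {s(x, y)}).Reachable y b := by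
  induction p with
  | nil => exact absurd ha hb
  | @cons a c b hadj q ih =>
    rw [Walk.cons_isPath_iff] at hp
    by_cases hc : P c
    · obtain ⟨x, y, hx, hy, hxy, hPx, hPy, hcx, hyb⟩ := ih hp.1 hc hb
      refine ⟨x, y, by simp [hx], by simp [hy], hxy, hPx, hPy, ?_, hyb⟩
      refine Reachable.trans (Adj.reachable ?_) hcx
      rw [deleteEdges_adj]
      refine ⟨hadj, fun h => ?_⟩
      rcases Sym2.eq_iff.1 (Set.mem_singleton_iff.1 h) with ⟨rfl, -⟩ | ⟨rfl, -⟩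
      · exact hp.2 hx
      · exact hp.2 hy
    · refine ⟨a, c, by simp, by simp, hadj, ha, hc, .rfl, ⟨q.toDeleteEdges _ fun e he h => ?_⟩⟩
      rw [Set.mem_singleton_iff] at h
      subst h
      exact hp.2 (q.fst_mem_support_of_mem_edges he)

end SimpleGraph

/-! ### Spanning trees of a multigraph and symmetric exchange. -/

namespace MSTInstance

variable {V : Type u} {E : Type v} (I : MSTInstance V E)

/-- The simple graph formed by the edges in `S`. -/
def edgeGraph (S : Finset E) : SimpleGraph V := SimpleGraph.fromEdgeSet (I.ends '' (S : Set E))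

variable {I}

lemma edgeGraph_adj {S : Finset E} {a b : V} :
    (I.edgeGraph S).Adj a b ↔ (∃ e ∈ S, I.ends e = s(a, b)) ∧ a ≠ b := by
  simp [edgeGraph]

/-- `T.card` counts loops and parallel edges while the simple graph forgets them, so connectedness
together with the right count excludes both. -/
lemma isSpanningTree_iff [Finite V] {T : Finset E} :
    I.IsSpanningTree T ↔ (I.edgeGraph T).Connected ∧ T.card + 1 = Nat.card V := by
  have hE : (I.edgeGraph T).edgeSet = (I.ends '' (T : Set E)) \ {e | e.IsDiag} :=
    SimpleGraph.edgeSet_fromEdgeSet _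
  have hfin : (I.ends '' (T : Set E)).Finite := T.finite_toSet.image _
  constructor
  · rintro ⟨hd, hi, ht⟩
    rw [SimpleGraph.isTree_iff_connected_and_card] at ht
    refine ⟨ht.1, ?_⟩
    rw [← ht.2]
    change _ = Nat.card (I.edgeGraph T).edgeSet + 1
    rw [hE, sdiff_eq_left.2, Nat.card_coe_set_eq, hi.ncard_image,
      Set.ncard_coe_finset]
    rw [Set.disjoint_left]
    rintro _ ⟨e, he, rfl⟩
    exact hd e he
  · rintro ⟨hc, hcard⟩
    have h1 := hc.card_vert_le_card_edgeSet_add_one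
    rw [hE, Nat.card_coe_set_eq] at h1
    have h2 : ((I.ends '' (T : Set E)) \ {e | e.IsDiag}).ncard ≤ (I.ends '' (T : Set E)).ncard :=
      Set.ncard_le_ncard Set.sdiff_subset hfin
    have h3 : (I.ends '' (T : Set E)).ncard ≤ T.card := by
      simpa using Set.ncard_image_le (f := I.ends) T.finite_toSet
    have h4 : (I.ends '' (T : Set E)) \ {e | e.IsDiag} = I.ends '' (T : Set E) :=
      Set.eq_of_subset_of_ncard_le Set.sdiff_subset (by omega) hfin
    refine ⟨fun e he hdiag => ?_, ?_, ?_⟩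
    · have : I.ends e ∈ (I.ends '' (T : Set E)) \ {e | e.IsDiag} := by
        rw [h4]; exact ⟨e, he, rfl⟩
      exact this.2 hdiag
    · apply Set.injOn_of_ncard_image_eq _ T.finite_toSet
      rw [Set.ncard_coe_finset]; omega
    · rw [SimpleGraph.isTree_iff_connected_and_card]
      refine ⟨hc, ?_⟩
      change Nat.card (I.edgeGraph T).edgeSet + 1 = _
      rw [hE, Nat.card_coe_set_eq]; omega

open Classical in
/-- The symmetric exchange property of spanning trees. -/
lemma IsSpanningTree.exists_symm_exchange [Finite V] {T T' : Finset E} (hT : I.IsSpanningTree T)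
    (hT' : I.IsSpanningTree T') {e : E} (he : e ∈ T) (he' : e ∉ T') :
    ∃ f ∈ T', f ∉ T ∧ I.IsSpanningTree (insert f (T.erase e)) ∧
      I.IsSpanningTree (insert e (T'.erase f)) := by
  rw [isSpanningTree_iff] at hT hT'
  obtain ⟨u, v, huv⟩ : ∃ u v, I.ends e = s(u, v) := by
    induction h : I.ends e using Sym2.ind with
    | _ u v => exact ⟨u, v, rfl⟩
  have hmono : ∀ {S S' : Finset E}, S ⊆ S' → I.edgeGraph S ≤ I.edgeGraph S' := fun hS =>
    SimpleGraph.fromEdgeSet_mono (Set.image_mono (by exact_mod_cast hS))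
  set H := I.edgeGraph (T.erase e) with hH
  have hcardT := Finset.card_erase_add_one he
  have hstep : ∀ {a b}, (I.edgeGraph T).Adj a b → H.Adj a b ∨ (s(a, b) = s(u, v)) := by
    intro a b hab
    obtain ⟨⟨g, hg, hgab⟩, hne⟩ := edgeGraph_adj.1 hab
    by_cases hge : g = e
    · subst hge; exact .inr (hgab.symm.trans huv)
    · exact .inl (edgeGraph_adj.2 ⟨⟨g, Finset.mem_erase.2 ⟨hge, hg⟩, hgab⟩, hne⟩)
  -- Otherwise `T` without `e` would still be connected, with too few edges.
  have hsep : ¬ H.Reachable u v := by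
    intro hr
    have hc : H.Connected := hT.1.of_adj_reachable fun a b hab => by
      rcases hstep hab with h | h
      · exact h.reachable
      · rcases Sym2.eq_iff.1 h with ⟨rfl, rfl⟩ | ⟨rfl, rfl⟩
        exacts [hr, hr.symm]
    have h1 := hc.card_vert_le_card_edgeSet_add_one
    have h2 : Nat.card H.edgeSet ≤ (T.erase e).card := by
      rw [hH, edgeGraph, SimpleGraph.edgeSet_fromEdgeSet, Nat.card_coe_set_eq]
      refine (Set.ncard_le_ncard Set.sdiff_subset ((T.erase e).finite_toSet.image _)).trans ?_
      exact (Set.ncard_image_le (T.erase e).finite_toSet).trans (Set.ncard_coe_finset _).le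
    omega
  have hcover : ∀ z, H.Reachable u z ∨ H.Reachable v z := by
    have haux : ∀ {z c} (_ : (I.edgeGraph T).Walk z c), H.Reachable u c →
        H.Reachable u z ∨ H.Reachable v z := by
      intro z c p hc
      induction p with
      | nil => exact .inl hc
      | cons hadj _ ih =>
        rcases hstep hadj with h | h
        · exact (ih hc).imp (·.trans h.symm.reachable) (·.trans h.symm.reachable)
        · rcases Sym2.eq_iff.1 h with ⟨rfl, -⟩ | ⟨rfl, -⟩
          exacts [.inl .rfl, .inr .rfl]
    intro z
    obtain ⟨p⟩ := hT.1.preconnected z u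
    exact haux p .rfl
  -- The path of `T'` between the ends of `e` crosses the cut that removing `e` leaves in `T`. The
  -- crossing edge `f` is on both fundamental cycles, so both exchanges work.
  obtain ⟨p, hp⟩ := (hT'.1.preconnected u v).exists_isPath
  obtain ⟨x, y, -, -, hxy, hx, hy, hux, hyv⟩ :=
    hp.exists_crossing_adj (P := fun z => H.Reachable u z) .rfl hsep
  obtain ⟨⟨f, hf, hfxy⟩, hne⟩ := edgeGraph_adj.1 hxy
  have hfe : f ≠ e := fun h => he' (h ▸ hf)
  have hfT : f ∉ T := fun hfT => hy (hx.trans (SimpleGraph.Adj.reachable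
    (edgeGraph_adj.2 ⟨⟨f, Finset.mem_erase.2 ⟨hfe, hfT⟩, hfxy⟩, hne⟩)))
  refine ⟨f, hf, hfT, isSpanningTree_iff.2 ⟨?_, ?_⟩, isSpanningTree_iff.2 ⟨?_, ?_⟩⟩
  · have hle : H ≤ I.edgeGraph (insert f (T.erase e)) := hmono (Finset.subset_insert _ _)
    have hr : (I.edgeGraph (insert f (T.erase e))).Reachable u v := by
      refine (hx.mono hle).trans (.trans (SimpleGraph.Adj.reachable
        (edgeGraph_adj.2 ⟨⟨f, Finset.mem_insert_self _ _, hfxy⟩, hne⟩)) ?_)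
      exact (((hcover y).resolve_left hy).mono hle).symm
    refine hT.1.of_adj_reachable fun a b hab => ?_
    rcases hstep hab with h | h
    · exact (hle h).reachable
    · rcases Sym2.eq_iff.1 h with ⟨rfl, rfl⟩ | ⟨rfl, rfl⟩
      exacts [hr, hr.symm]
  · rw [Finset.card_insert_of_notMem (by simp [hfT])]; omega
  · have hdel : (I.edgeGraph T').deleteEdges {s(x, y)} ≤
        I.edgeGraph (insert e (T'.erase f)) := by
      intro a b hab
      rw [SimpleGraph.deleteEdges_adj] at hab
      obtain ⟨⟨g, hg, hgab⟩, hne⟩ := edgeGraph_adj.1 hab.1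
      refine edgeGraph_adj.2 ⟨⟨g, ?_, hgab⟩, hne⟩
      refine Finset.mem_insert_of_mem (Finset.mem_erase.2 ⟨?_, hg⟩)
      rintro rfl
      exact hab.2 (hgab.symm.trans hfxy)
    have hr : (I.edgeGraph (insert e (T'.erase f))).Reachable x y := by
      refine (hux.mono hdel).symm.trans (.trans (SimpleGraph.Adj.reachable ?_) (hyv.mono hdel).symm)
      refine edgeGraph_adj.2 ⟨⟨e, Finset.mem_insert_self _ _, huv⟩, ?_⟩
      rintro rfl
      exact hsep .rfl
    refine hT'.1.of_adj_reachable fun a b hab => ?_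
    by_cases h : s(a, b) = s(x, y)
    · rcases Sym2.eq_iff.1 h with ⟨rfl, rfl⟩ | ⟨rfl, rfl⟩
      exacts [hr, hr.symm]
    · exact (hdel (SimpleGraph.deleteEdges_adj.2 ⟨hab, h⟩)).reachable
  · rw [Finset.card_insert_of_notMem (by simp [he'])]
    have := Finset.card_erase_add_one hf
    omega

end MSTInstance

namespace MSTInstance

/-! ### Exchange pairs and local optimality. -/

section Exchange

variable {V : Type u} {E : Type v} {I : MSTInstance V E}

variable (I) in
open Classical in
/-- `f ∉ T` can replace `e ∈ T` in the spanning tree `T`: for a spanning tree this means that `e`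
lies on the cycle that `f` closes with `T`. -/
def Exchangeable (T : Finset E) (e f : E) : Prop :=
  e ∈ T ∧ f ∉ T ∧ I.IsSpanningTree (insert f (T.erase e))

lemma IsMST.le_of_exchangeable {w : E → ℝ} {T : Finset E} (h : I.IsMST w T) {e f : E}
    (hef : I.Exchangeable T e f) : w e ≤ w f := by
  classical
  have h1 := h.2 _ hef.2.2
  rw [Finset.sum_insert (by simp [hef.2.1]), ← Finset.add_sum_erase T w hef.1] at h1
  linarith

/-- Local optimality is global: a symmetric exchange moves a competitor one edge closer to `T`
without increasing its weight. -/
lemma isMST_of_exchangeable_le [Finite V] {w : E → ℝ} {T : Finset E} (hT : I.IsSpanningTree T)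
    (h : ∀ e f, I.Exchangeable T e f → w e ≤ w f) : I.IsMST w T := by
  classical
  refine ⟨hT, ?_⟩
  suffices ∀ n, ∀ T', I.IsSpanningTree T' → (T \ T').card = n → ∑ e ∈ T, w e ≤ ∑ e ∈ T', w e from
    fun T' hT' => this _ T' hT' rfl
  intro n
  induction n with
  | zero =>
    intro T' hT' hn
    have hsub : T ⊆ T' := by rwa [Finset.card_eq_zero, Finset.sdiff_eq_empty_iff_subset] at hn
    have hcard := (isSpanningTree_iff.1 hT).2.trans (isSpanningTree_iff.1 hT').2.symm
    rw [Finset.eq_of_subset_of_card_le hsub (by omega)]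
  | succ n ih =>
    intro T' hT' hn
    obtain ⟨e, he⟩ : (T \ T').Nonempty := by rw [← Finset.card_pos]; omega
    rw [Finset.mem_sdiff] at he
    obtain ⟨f, hf, hfT, h1, h2⟩ := hT.exists_symm_exchange hT' he.1 he.2
    have hle := h e f ⟨he.1, hfT, h1⟩
    have hsd : T \ insert e (T'.erase f) = (T \ T').erase e := by
      ext x
      simp only [Finset.mem_sdiff, Finset.mem_insert, Finset.mem_erase, not_or, not_and]
      constructor
      · rintro ⟨hx, hxe, hxf⟩
        exact ⟨hxe, hx, hxf fun h => hfT (h ▸ hx)⟩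
      · rintro ⟨hxe, hx, hxT⟩
        exact ⟨hx, hxe, fun _ => hxT⟩
    have h3 := ih _ h2 (by
      rw [hsd, Finset.card_erase_of_mem (Finset.mem_sdiff.2 he)]; omega)
    rw [Finset.sum_insert (by simp [he.2])] at h3
    rw [← Finset.add_sum_erase T' w hf]
    linarith

lemma exists_isMST [Finite E] (w : E → ℝ) (h : ∃ T, I.IsSpanningTree T) : ∃ T, I.IsMST w T := by
  have := Fintype.ofFinite E
  classical
  obtain ⟨T, hT, hmin⟩ := Finset.exists_min_image (Finset.univ.filter I.IsSpanningTree)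
    (fun T => ∑ e ∈ T, w e) (by obtain ⟨T, hT⟩ := h; exact ⟨T, by simpa using hT⟩)
  exact ⟨T, by simpa using hT, fun T' hT' => hmin T' (by simpa using hT')⟩

/-- Symmetric exchange of `e` between `T'` and the tree `T - e + f`: if the partner `g` is not `f`,
then `T - e + f - g + e` is `T - g + f`. -/
lemma Exchangeable.exists_exchangeable_of_mem [Finite V] {T T' : Finset E} {e f : E}
    (h : I.Exchangeable T e f) (hT' : I.IsSpanningTree T') (he : e ∈ T') :
    ∃ g, I.Exchangeable T' e g ∧ (g = f ∨ I.Exchangeable T g f) := by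
  classical
  obtain ⟨heT, hfT, htree⟩ := h
  have hfe : e ≠ f := fun h => hfT (h ▸ heT)
  obtain ⟨g, hg, hgT', h1, h2⟩ := hT'.exists_symm_exchange htree he (by simp [hfe])
  refine ⟨g, ⟨he, hgT', h1⟩, or_iff_not_imp_left.2 fun hgf => ?_⟩
  obtain ⟨hge, hgT⟩ := Finset.mem_erase.1 (Finset.mem_of_mem_insert_of_ne hg hgf)
  refine ⟨hgT, hfT, ?_⟩
  convert h2 using 1
  ext x
  simp only [Finset.mem_insert, Finset.mem_erase]
  by_cases hxe : x = e
  · subst hxe; simp [heT, hge.symm]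
  · by_cases hxf : x = f
    · subst hxf; simp [Ne.symm hgf]
    · simp [hxe, hxf]

lemma Exchangeable.exists_exchangeable_of_notMem [Finite V] {T T' : Finset E} {e f : E}
    (h : I.Exchangeable T e f) (hT' : I.IsSpanningTree T') (hf : f ∉ T') :
    ∃ g, I.Exchangeable T' g f ∧ (g = e ∨ I.Exchangeable T e g) := by
  classical
  obtain ⟨heT, hfT, htree⟩ := h
  have hfe : e ≠ f := fun h => hfT (h ▸ heT)
  obtain ⟨g, hg, hgT, h1, h2⟩ := htree.exists_symm_exchange hT' (Finset.mem_insert_self _ _) hf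
  refine ⟨g, ⟨hg, hf, h2⟩, or_iff_not_imp_left.2 fun hge => ⟨heT, ?_, ?_⟩⟩
  · intro h
    exact hgT (Finset.mem_insert_of_mem (Finset.mem_erase.2 ⟨hge, h⟩))
  · rwa [Finset.erase_insert (by simp [hfT])] at h1

end Exchange

/-! ### Membership in uncertainty intervals. -/

section Intervals

variable {V : Type u} {E : Type v} {I : MSTInstance V E}

lemma lo_le_of_mem {e : E} {x : ℝ} (hx : x ∈ I.interval e) : I.lo e ≤ x := by
  unfold interval uncertaintyInterval at hx
  split_ifs at hx with h
  · exact hx.ge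
  · exact hx.1.le

lemma le_hi_of_mem {e : E} {x : ℝ} (hx : x ∈ I.interval e) : x ≤ I.hi e := by
  unfold interval uncertaintyInterval at hx
  split_ifs at hx with h
  · exact h ▸ (Set.mem_singleton_iff.1 hx).le
  · exact hx.2.le

lemma lo_lt_of_mem {e : E} (he : ¬ I.Trivial e) {x : ℝ} (hx : x ∈ I.interval e) : I.lo e < x := by
  unfold interval uncertaintyInterval at hx
  rw [if_neg (show ¬ I.lo e = I.hi e from he)] at hx
  exact hx.1

lemma lt_hi_of_mem {e : E} (he : ¬ I.Trivial e) {x : ℝ} (hx : x ∈ I.interval e) : x < I.hi e := by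
  unfold interval uncertaintyInterval at hx
  rw [if_neg (show ¬ I.lo e = I.hi e from he)] at hx
  exact hx.2

lemma exists_mem_interval_gt {e : E} {x : ℝ} (hx : x < I.hi e) : ∃ y ∈ I.interval e, x < y := by
  unfold interval uncertaintyInterval
  split_ifs with h
  · exact ⟨_, rfl, h ▸ hx⟩
  · obtain ⟨y, hy1, hy2⟩ := exists_between (max_lt hx (lt_of_le_of_ne (I.lo_le_hi e) h))
    exact ⟨y, ⟨(le_max_right _ _).trans_lt hy1, hy2⟩, (le_max_left _ _).trans_lt hy1⟩

lemma exists_mem_interval_lt {e : E} {x : ℝ} (hx : I.lo e < x) : ∃ y ∈ I.interval e, y < x := by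
  unfold interval uncertaintyInterval
  split_ifs with h
  · exact ⟨_, rfl, hx⟩
  · obtain ⟨y, hy1, hy2⟩ := exists_between (lt_min hx (lt_of_le_of_ne (I.lo_le_hi e) h))
    exact ⟨y, ⟨hy1, hy2.trans_le (min_le_right _ _)⟩, hy2.trans_le (min_le_left _ _)⟩

end Intervals

/-! ### Inequalities forced by a certificate. -/

section Certificates

variable {V : Type u} {E : Type v} {I : MSTInstance V E} {w : E → ℝ} {F T : Finset E}

lemma Certifies.isSpanningTree (hw : I.IsRealization w) (h : I.Certifies w F T) :
    I.IsSpanningTree T := (h w hw fun _ _ => rfl).1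

lemma Certifies.le (hw : I.IsRealization w) (h : I.Certifies w F T) {e f : E}
    (hef : I.Exchangeable T e f) {x y : ℝ} (hx : x ∈ I.interval e) (hy : y ∈ I.interval f)
    (hxF : e ∈ F → x = w e) (hyF : f ∈ F → y = w f) : x ≤ y := by
  classical
  have hne : e ≠ f := fun h => hef.2.1 (h ▸ hef.1)
  have h1 := (h (Function.update (Function.update w e x) f y) ?_ ?_).le_of_exchangeable hef
  · simpa [hne] using h1
  · intro g
    by_cases hgf : g = f
    · subst hgf; simpa using hy
    · by_cases hge : g = e
      · subst hge; simpa [hgf] using hx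
      · simpa [hgf, hge] using hw g
  · intro g hg
    by_cases hgf : g = f
    · subst hgf; simpa using hyF hg
    · by_cases hge : g = e
      · subst hge; simpa [hgf] using hxF hg
      · simp [hgf, hge]

/-- The unqueried `e` may take values arbitrarily close to `I.hi e` while `f` keeps its true weight.
-/
lemma Certifies.hi_le_weight (hw : I.IsRealization w) (h : I.Certifies w F T) {e f : E}
    (hef : I.Exchangeable T e f) (he : e ∉ F) : I.hi e ≤ w f := by
  by_contra! hlt
  obtain ⟨x, hx, hlt⟩ := exists_mem_interval_gt hlt
  exact hlt.not_ge (h.le hw hef hx (hw f) (fun h => absurd h he) fun _ => rfl)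

lemma Certifies.weight_le_lo (hw : I.IsRealization w) (h : I.Certifies w F T) {e f : E}
    (hef : I.Exchangeable T e f) (hf : f ∉ F) : w e ≤ I.lo f := by
  by_contra! hlt
  obtain ⟨x, hx, hlt⟩ := exists_mem_interval_lt hlt
  exact hlt.not_ge (h.le hw hef (hw e) hx (fun _ => rfl) fun h => absurd h hf)

lemma Certifies.hi_le_lo (hw : I.IsRealization w) (h : I.Certifies w F T) {e f : E}
    (hef : I.Exchangeable T e f) (he : e ∉ F) (hf : f ∉ F) : I.hi e ≤ I.lo f := by
  by_contra! hlt
  obtain ⟨x, hx, hlt⟩ := exists_mem_interval_gt hlt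
  obtain ⟨y, hy, hlt⟩ := exists_mem_interval_lt hlt
  exact hlt.not_ge (h.le hw hef hx hy (fun h => absurd h he) fun h => absurd h hf)

lemma certifies_of_exchangeable_le [Finite V] (hT : I.IsSpanningTree T)
    (h : ∀ w', I.IsRealization w' → (∀ e ∈ F, w' e = w e) →
      ∀ e f, I.Exchangeable T e f → w' e ≤ w' f) : I.Certifies w F T :=
  fun w' hw' hF => isMST_of_exchangeable_le hT (h w' hw' hF)

lemma Certifies.mono (h : I.Certifies w F T) {F' : Finset E} (hF : F ⊆ F') :
    I.Certifies w F' T := fun w' hw' h' => h w' hw' fun e he => h' e (hF he)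

lemma Certifies.congr (h : I.Certifies w F T) {w' : E → ℝ} (hw : ∀ e ∈ F, w e = w' e) :
    I.Certifies w' F T := fun v hv h' => h v hv fun e he => (h' e he).trans (hw e he).symm

end Certificates

/-! ### Limit trees and what unqueried edges imply. -/

section LimitTrees

variable {V : Type u} {E : Type v} {I : MSTInstance V E} {T : Finset E}

variable (I) in
/-- A description without `ε` of the lower limit trees. -/
structure LowerOptimal (T : Finset E) : Prop where
  isSpanningTree : I.IsSpanningTree T
  lo_le : ∀ e f, I.Exchangeable T e f → I.lo e ≤ I.lo f
  lo_lt : ∀ e f, I.Exchangeable T e f → ¬ I.Trivial e → I.Trivial f → I.lo e < I.lo f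

variable (I) in
/-- A description without `ε` of the upper limit trees. -/
structure UpperOptimal (T : Finset E) : Prop where
  isSpanningTree : I.IsSpanningTree T
  hi_le : ∀ e f, I.Exchangeable T e f → I.hi e ≤ I.hi f
  hi_lt : ∀ e f, I.Exchangeable T e f → I.Trivial e → ¬ I.Trivial f → I.hi e < I.hi f

lemma lo_le_lowerWeight {ε : ℝ} (hε : 0 ≤ ε) (e : E) : I.lo e ≤ I.lowerWeight ε e := by
  unfold lowerWeight; split_ifs <;> linarith

lemma lowerWeight_le {ε : ℝ} (hε : 0 ≤ ε) (e : E) : I.lowerWeight ε e ≤ I.lo e + ε := by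
  unfold lowerWeight; split_ifs <;> linarith

lemma upperWeight_le_hi {ε : ℝ} (hε : 0 ≤ ε) (e : E) : I.upperWeight ε e ≤ I.hi e := by
  unfold upperWeight; split_ifs <;> linarith

lemma le_upperWeight {ε : ℝ} (hε : 0 ≤ ε) (e : E) : I.hi e - ε ≤ I.upperWeight ε e := by
  unfold upperWeight; split_ifs <;> linarith

lemma IsLowerLimitTree.lowerOptimal (h : I.IsLowerLimitTree T) : I.LowerOptimal T := by
  obtain ⟨ε₀, hε₀, h⟩ := h
  have hle : ∀ e f, I.Exchangeable T e f → ∀ ε, 0 < ε → ε < ε₀ →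
      I.lowerWeight ε e ≤ I.lowerWeight ε f :=
    fun e f hef ε h1 h2 => (h ε h1 h2).le_of_exchangeable hef
  refine ⟨(h (ε₀ / 2) (by linarith) (by linarith)).1, fun e f hef => ?_, fun e f hef he hf => ?_⟩
  · by_contra! hlt
    set ε := min (ε₀ / 2) ((I.lo e - I.lo f) / 2)
    have hε : 0 < ε := lt_min (by linarith) (by linarith)
    have h1 := hle e f hef ε hε ((min_le_left _ _).trans_lt (by linarith))
    have h2 := I.lo_le_lowerWeight hε.le e
    have h3 := I.lowerWeight_le hε.le f
    have h4 : ε ≤ (I.lo e - I.lo f) / 2 := min_le_right _ _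
    linarith
  · have h1 := hle e f hef (ε₀ / 2) (by linarith) (by linarith)
    rw [lowerWeight, lowerWeight, if_neg he, if_pos hf] at h1
    linarith

lemma IsUpperLimitTree.upperOptimal (h : I.IsUpperLimitTree T) : I.UpperOptimal T := by
  obtain ⟨ε₀, hε₀, h⟩ := h
  have hle : ∀ e f, I.Exchangeable T e f → ∀ ε, 0 < ε → ε < ε₀ →
      I.upperWeight ε e ≤ I.upperWeight ε f :=
    fun e f hef ε h1 h2 => (h ε h1 h2).le_of_exchangeable hef
  refine ⟨(h (ε₀ / 2) (by linarith) (by linarith)).1, fun e f hef => ?_, fun e f hef he hf => ?_⟩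
  · by_contra! hlt
    set ε := min (ε₀ / 2) ((I.hi e - I.hi f) / 2)
    have hε : 0 < ε := lt_min (by linarith) (by linarith)
    have h1 := hle e f hef ε hε ((min_le_left _ _).trans_lt (by linarith))
    have h2 := I.le_upperWeight hε.le e
    have h3 := I.upperWeight_le_hi hε.le f
    have h4 : ε ≤ (I.hi e - I.hi f) / 2 := min_le_right _ _
    linarith
  · have h1 := hle e f hef (ε₀ / 2) (by linarith) (by linarith)
    rw [upperWeight, upperWeight, if_pos he, if_neg hf] at h1
    linarith

lemma exists_lowerOptimal [Finite E] (h : ∃ T, I.IsSpanningTree T) : ∃ T, I.LowerOptimal T := by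
  -- Below every positive gap between lower limits, a single `ε` already yields the `ε`-free
  -- conditions.
  obtain ⟨ε, hgap, hε⟩ : ∃ ε, (∀ e f, I.lo f < I.lo e → I.lo f + ε < I.lo e) ∧ 0 < ε := by
    have h1 : ∀ᶠ ε : ℝ in nhdsWithin 0 (Set.Ioi 0),
        ∀ e f, I.lo f < I.lo e → I.lo f + ε < I.lo e := by
      simp only [Filter.eventually_all]
      intro e f hlt
      refine nhdsWithin_le_nhds ?_
      filter_upwards [Iio_mem_nhds (sub_pos.2 hlt)] with ε hε
      rw [Set.mem_Iio] at hε; linarith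
    exact (h1.and self_mem_nhdsWithin).exists
  obtain ⟨T, hT⟩ := exists_isMST (I.lowerWeight ε) h
  refine ⟨T, hT.1, fun e f hef => ?_, fun e f hef he hf => ?_⟩
  · have h1 := hT.le_of_exchangeable hef
    by_contra! hlt
    have h2 := I.lo_le_lowerWeight hε.le e
    have h3 := I.lowerWeight_le hε.le f
    have h4 := hgap e f hlt
    linarith
  · have h1 := hT.le_of_exchangeable hef
    rw [lowerWeight, lowerWeight, if_neg he, if_pos hf] at h1
    linarith

lemma LowerOptimal.lo_lt_of_mem (h : I.LowerOptimal T) {e f : E} (hef : I.Exchangeable T e f)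
    (he : ¬ I.Trivial e) {x : ℝ} (hx : x ∈ I.interval f) : I.lo e < x := by
  by_cases hf : I.Trivial f
  · exact (h.lo_lt e f hef he hf).trans_le (lo_le_of_mem hx)
  · exact (h.lo_le e f hef).trans_lt (I.lo_lt_of_mem hf hx)

lemma UpperOptimal.lt_hi_of_mem (h : I.UpperOptimal T) {e f : E} (hef : I.Exchangeable T e f)
    (hf : ¬ I.Trivial f) {x : ℝ} (hx : x ∈ I.interval e) : x < I.hi f := by
  by_cases he : I.Trivial e
  · exact (le_hi_of_mem hx).trans_lt (h.hi_lt e f hef he hf)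
  · exact (I.lt_hi_of_mem he hx).trans_le (h.hi_le e f hef)

lemma LowerOptimal.not_trivial (h : I.LowerOptimal T) {e f : E} (hef : I.Exchangeable T e f)
    (hlt : I.lo f < I.hi e) : ¬ I.Trivial e := fun he =>
  hlt.not_ge ((show I.hi e = I.lo e from he.symm) ▸ h.lo_le e f hef)

lemma UpperOptimal.not_trivial (h : I.UpperOptimal T) {e f : E} (hef : I.Exchangeable T e f)
    (hlt : I.lo f < I.hi e) : ¬ I.Trivial f := fun hf =>
  hlt.not_ge ((show I.lo f = I.hi f from hf) ▸ h.hi_le e f hef)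

variable {w : E → ℝ} {F T' : Finset E}

/-- If `e` left the tree, its symmetric exchange partner `g` would have a weight strictly above
`I.lo e` by lower optimality, yet the certificate forces the reverse because `e` is unqueried. -/
lemma LowerOptimal.mem_of_certifies [Finite V] (h : I.LowerOptimal T) (hw : I.IsRealization w)
    (hF : I.Certifies w F T') {e : E} (heT : e ∈ T) (he : ¬ I.Trivial e) (heF : e ∉ F) :
    e ∈ T' := by
  by_contra heT'
  obtain ⟨g, hg, hgT, h1, h2⟩ :=
    h.isSpanningTree.exists_symm_exchange (hF.isSpanningTree hw) heT heT'
  exact (h.lo_lt_of_mem ⟨heT, hgT, h1⟩ he (hw g)).not_ge (hF.weight_le_lo hw ⟨hg, heT', h2⟩ heF)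

lemma UpperOptimal.notMem_of_certifies [Finite V] (h : I.UpperOptimal T) (hw : I.IsRealization w)
    (hF : I.Certifies w F T') {f : E} (hfT : f ∉ T) (hf : ¬ I.Trivial f) (hfF : f ∉ F) :
    f ∉ T' := by
  intro hfT'
  obtain ⟨g, hg, hgT', h1, h2⟩ :=
    (hF.isSpanningTree hw).exists_symm_exchange h.isSpanningTree hfT' hfT
  exact (h.lt_hi_of_mem ⟨hg, hfT, h2⟩ hf (hw g)).not_ge (hF.hi_le_weight hw ⟨hfT', hgT', h1⟩ hfF)

/-- If neither end of an overlapping pair is queried, the tree edge is beaten on its cycle by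
another edge whose interval overlaps that of the non-tree edge. -/
lemma LowerOptimal.exists_hi_le_weight [Finite V] (h : I.LowerOptimal T) (hw : I.IsRealization w)
    (hF : I.Certifies w F T') {e f : E} (hef : I.Exchangeable T e f) (hlt : I.lo f < I.hi e)
    (heF : e ∉ F) (hwf : f ∉ F ∨ w f < I.hi e) :
    ∃ g, I.Exchangeable T g f ∧ I.lo f < I.hi g ∧ I.hi e ≤ w g ∧ I.hi e < I.hi g := by
  have he := h.mem_of_certifies hw hF hef.1 (h.not_trivial hef hlt) heF
  obtain ⟨g, hg, hgf⟩ := hef.exists_exchangeable_of_mem (hF.isSpanningTree hw) he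
  have h1 := hF.hi_le_weight hw hg heF
  rcases hgf with rfl | hgf
  · rcases hwf with hwf | hwf
    · exact absurd (hF.hi_le_lo hw hg heF hwf) hlt.not_ge
    · exact absurd h1 hwf.not_ge
  -- Here `g` is non-trivial, so its interval is open and `w g < I.hi g`. This strictness
  -- contradicts extremal choices of `e` later on.
  · have h2 := le_hi_of_mem (hw g)
    have h3 := h.not_trivial hgf (by linarith)
    have h4 := I.lt_hi_of_mem h3 (hw g)
    exact ⟨g, hgf, by linarith, h1, by linarith⟩

/-- Dual to `LowerOptimal.exists_hi_le_weight`: upper optimality keeps the unqueried `f` out of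
`T'`, and a non-tree edge with smaller lower limit takes over its comparison with `e`. -/
lemma UpperOptimal.exists_weight_le_lo [Finite V] (h : I.UpperOptimal T) (hw : I.IsRealization w)
    (hF : I.Certifies w F T') {e f : E} (hef : I.Exchangeable T e f) (hlt : I.lo f < I.hi e)
    (hfF : f ∉ F) (hwe : e ∉ F ∨ I.lo f < w e) :
    ∃ g, I.Exchangeable T e g ∧ I.lo g < I.hi e ∧ w g ≤ I.lo f ∧ I.lo g < I.lo f := by
  have hf := h.notMem_of_certifies hw hF hef.2.1 (h.not_trivial hef hlt) hfF
  obtain ⟨g, hg, hge⟩ := hef.exists_exchangeable_of_notMem (hF.isSpanningTree hw) hf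
  have h1 := hF.weight_le_lo hw hg hfF
  rcases hge with rfl | hge
  · rcases hwe with hwe | hwe
    · exact absurd (hF.hi_le_lo hw hg hwe hfF) hlt.not_ge
    · exact absurd h1 hwe.not_ge
  · have h2 := lo_le_of_mem (hw g)
    have h3 := h.not_trivial hge (by linarith)
    have h4 := I.lo_lt_of_mem h3 (hw g)
    exact ⟨g, hge, by linarith, h1, by linarith⟩

end LimitTrees

end MSTInstance

/-! ### Batches of queries. -/

namespace QueryStrategy

variable {E : Type v}

open Classical in
/-- Query all edges of a list, then continue depending on the known weights: those given in advance
by `r`, updated by the revealed ones. -/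
noncomputable def queryAll : List E → (E → ℝ) → ((E → ℝ) → QueryStrategy E) → QueryStrategy E
  | [], r, k => k r
  | e :: l, r, k => query e fun x => queryAll l (Function.update r e x) k

open Classical in
-- A continuation only needs its state `r'` to be correct on the edges whose weights are known by
-- then.
lemma queryAll_run (k : (E → ℝ) → QueryStrategy E) (w : E → ℝ) (l : List E) :
    ∀ r, ∃ r', (∀ e, e ∈ l ∨ r e = w e → r' e = w e) ∧
      (queryAll l r k).queries w = l ++ (k r').queries w ∧
      (queryAll l r k).result w = (k r').result w := by
  induction l with
  | nil => exact fun r => ⟨r, fun e he => he.resolve_left (by simp), rfl, rfl⟩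
  | cons a l ih =>
    intro r
    obtain ⟨r', h1, h2, h3⟩ := ih (Function.update r a (w a))
    refine ⟨r', fun e he => h1 e ?_, by simp only [queryAll, queries, h2, List.cons_append], by
      simp only [queryAll, result, h3]⟩
    by_cases hea : e = a
    · subst hea; simp
    · simpa [hea] using he

end QueryStrategy

/-! ### Revealed instances and a robust continuation by witness pairs. -/

namespace MSTInstance

variable {V : Type u} {E : Type v} {I : MSTInstance V E}

open Classical in
/-- The instance that results from revealing the weights of the edges in `Q`. -/
noncomputable def reveal (I : MSTInstance V E) (Q : Finset E) {w : E → ℝ}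
    (hw : I.IsRealization w) : MSTInstance V E where
  ends := I.ends
  lo e := if e ∈ Q then w e else I.lo e
  hi e := if e ∈ Q then w e else I.hi e
  pred := w
  lo_nonneg e := by
    split_ifs
    · exact (I.lo_nonneg e).trans (lo_le_of_mem (hw e))
    · exact I.lo_nonneg e
  lo_le_hi e := by
    split_ifs
    · exact le_rfl
    · exact I.lo_le_hi e
  pred_mem e := by
    split_ifs
    · simp [uncertaintyInterval]
    · exact hw e

lemma isRealization_reveal {Q : Finset E} {w : E → ℝ} {hw : I.IsRealization w} {w' : E → ℝ} :
    (I.reveal Q hw).IsRealization w' ↔ I.IsRealization w' ∧ ∀ e ∈ Q, w' e = w e := by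
  have key : ∀ e, w' e ∈ (I.reveal Q hw).interval e ↔
      w' e ∈ I.interval e ∧ (e ∈ Q → w' e = w e) := by
    intro e
    by_cases he : e ∈ Q
    · simp only [interval, reveal, he, uncertaintyInterval, if_true, Set.mem_singleton_iff,
        forall_const, iff_and_self]
      intro h
      rw [h]
      exact hw e
    · simp [interval, reveal, he]
  simp only [IsRealization, key, forall_and]

open Classical in
lemma Certifies.reveal {Q F T : Finset E} {w₀ w : E → ℝ} {hw₀ : I.IsRealization w₀}
    (hw : (I.reveal Q hw₀).IsRealization w) (h : I.Certifies w F T) :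
    (I.reveal Q hw₀).Certifies w (F \ Q) T := by
  intro w' hw' hF
  rw [isRealization_reveal] at hw hw'
  refine h w' hw'.1 fun e he => ?_
  by_cases heQ : e ∈ Q
  · rw [hw'.2 e heQ, hw.2 e heQ]
  · exact hF e (Finset.mem_sdiff.2 ⟨he, heQ⟩)

open Classical in
lemma certifies_of_reveal_empty {Q T : Finset E} {w₀ w : E → ℝ} {hw₀ : I.IsRealization w₀}
    (hw : (I.reveal Q hw₀).IsRealization w) (h : (I.reveal Q hw₀).Certifies w ∅ T) :
    I.Certifies w Q T := by
  intro w' hw' hQ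
  rw [isRealization_reveal] at hw
  refine h w' (isRealization_reveal.2 ⟨hw', fun e he => ?_⟩) (by simp)
  rw [hQ e he, hw.2 e he]

/-- An instance that cannot be solved without queries has two edges that meet every feasible query
set, for all true weights. -/
lemma exists_witness_pair [Finite V] [Finite E] (hT : ∃ T, I.IsSpanningTree T)
    (h : ∀ w, ¬ ∃ T, I.Certifies w ∅ T) :
    ∃ a b, ∀ w, I.IsRealization w → ∀ F, I.IsFeasible w F → a ∈ F ∨ b ∈ F := by
  have := Fintype.ofFinite E
  classical
  obtain ⟨T, hT⟩ := exists_lowerOptimal hT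
  obtain ⟨e₀, f, hef, hlt⟩ : ∃ e f, I.Exchangeable T e f ∧ I.lo f < I.hi e := by
    by_contra! hle
    refine h I.pred ⟨T, certifies_of_exchangeable_le hT.isSpanningTree ?_⟩
    exact fun w' hw' _ e f hef =>
      (le_hi_of_mem (hw' e)).trans ((hle e f hef).trans (lo_le_of_mem (hw' f)))
  -- With `I.hi e` maximal among tree edges on the cycle of `f`, no edge can beat `e` as
  -- `exists_hi_le_weight` would demand.
  obtain ⟨e, he, hmax⟩ := Finset.exists_max_image
    (Finset.univ.filter fun e => I.Exchangeable T e f) I.hi ⟨e₀, by simpa using hef⟩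
  simp only [Finset.mem_filter, Finset.mem_univ, true_and] at he hmax
  refine ⟨e, f, fun w hw F ⟨T', hF⟩ => ?_⟩
  by_contra! hnot
  obtain ⟨g, hg, -, -, hlt'⟩ := hT.exists_hi_le_weight hw hF he
    (hlt.trans_le (hmax e₀ hef)) hnot.1 (.inl hnot.2)
  exact hlt'.not_ge (hmax g hg)

open Classical in
/-- From every state of knowledge the instance can be solved with at most twice the number of
further queries that any feasible query set needs. -/
lemma exists_robust_continuation [Finite V] [Finite E] (hT : ∃ T, I.IsSpanningTree T)
    (Q : Finset E) (r : E → ℝ) : ∃ S : QueryStrategy E, ∀ w, I.IsRealization w →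
      (∀ e ∈ Q, r e = w e) →
        I.Certifies w (Q ∪ (S.queries w).toFinset) (S.result w) ∧
        ∀ F, I.IsFeasible w F → (S.queries w).length ≤ 2 * (F \ Q).card := by
  have := Fintype.ofFinite E
  induction hn : (Finset.univ \ Q).card using Nat.strong_induction_on generalizing Q r with
  | _ n ih =>
  by_cases hr : ∃ w₀, I.IsRealization w₀ ∧ ∀ e ∈ Q, r e = w₀ e
  swap
  -- The recorded weights are impossible, so the output is irrelevant.
  · exact ⟨.output ∅, fun w hw h => absurd ⟨w, hw, h⟩ hr⟩
  obtain ⟨w₀, hw₀, hrw₀⟩ := hr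
  have hreal : ∀ {w}, I.IsRealization w → (∀ e ∈ Q, r e = w e) →
      (I.reveal Q hw₀).IsRealization w := fun hw h =>
    isRealization_reveal.2 ⟨hw, fun e he => (h e he).symm.trans (hrw₀ e he)⟩
  by_cases hcert : ∃ w T, (I.reveal Q hw₀).Certifies w ∅ T
  · obtain ⟨w₁, T, hcert⟩ := hcert
    refine ⟨.output T, fun w hw h => ⟨?_, fun F _ => by simp [QueryStrategy.queries]⟩⟩
    simpa [QueryStrategy.queries, QueryStrategy.result] using
      certifies_of_reveal_empty (hreal hw h) (hcert.congr (by simp))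
  obtain ⟨a, b, hab⟩ := exists_witness_pair (I := I.reveal Q hw₀) hT
    fun w hw => hcert ⟨w, hw⟩
  set W : Finset E := ({a, b} : Finset E) \ Q with hW
  have hhit : ∀ w, I.IsRealization w → (∀ e ∈ Q, r e = w e) → ∀ F, I.IsFeasible w F →
      ∃ e ∈ W, e ∈ F \ Q := by
    rintro w hw h F ⟨T, hF⟩
    rcases hab w (hreal hw h) _ ⟨T, hF.reveal (hreal hw h)⟩ with ha | ha
    · exact ⟨a, by simp [hW, (Finset.mem_sdiff.1 ha).2], ha⟩
    · exact ⟨b, by simp [hW, (Finset.mem_sdiff.1 ha).2], ha⟩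
  have hlt : (Finset.univ \ (Q ∪ W)).card < n := by
    -- The set of all edges is feasible, so it meets `W`; hence `W` is nonempty and the recursion
    -- terminates.
    obtain ⟨e, he, heF⟩ := hhit w₀ hw₀ hrw₀ Finset.univ <| by
      obtain ⟨T, hT⟩ := exists_isMST w₀ hT
      exact ⟨T, fun w' _ h => by rwa [funext fun e => h e (Finset.mem_univ e)]⟩
    rw [← hn]
    refine Finset.card_lt_card (Finset.ssubset_iff_of_subset ?_ |>.2 ⟨e, heF, by simp [he]⟩)
    exact Finset.sdiff_subset_sdiff le_rfl Finset.subset_union_left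
  choose k hk using fun r' => ih _ hlt (Q ∪ W) r' rfl
  refine ⟨.queryAll W.toList r k, fun w hw h => ?_⟩
  obtain ⟨r', h1, h2, h3⟩ := QueryStrategy.queryAll_run k w W.toList r
  obtain ⟨h4, h5⟩ := hk r' w hw fun e he => h1 e (by
    rcases Finset.mem_union.1 he with he | he
    · exact .inr (h e he)
    · exact .inl (by simpa using he))
  rw [h2, h3]
  refine ⟨?_, fun F hF => ?_⟩
  · simpa [List.toFinset_append, Finset.union_assoc] using h4
  · have h6 := h5 F hF
    obtain ⟨e, heW, heF⟩ := hhit w hw h F hF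
    have h7 : (F \ (Q ∪ W)).card < (F \ Q).card :=
      Finset.card_lt_card (Finset.ssubset_iff_of_subset
        (Finset.sdiff_subset_sdiff le_rfl Finset.subset_union_left) |>.2 ⟨e, heF, by simp [heW]⟩)
    have h8 : W.card ≤ 2 := (Finset.card_le_card Finset.sdiff_subset).trans Finset.card_le_two
    rw [List.length_append, Finset.length_toList]
    omega

end MSTInstance

/-! ### König's theorem from Hall's theorem. -/

namespace Finset

open Classical in
/-- A minimum vertex cover of a bipartite relation can be matched injectively into its complement
(a form of König's theorem). -/
lemma exists_matched_vertexCover {E : Type v} [Fintype E] (A : Finset E) (R : E → E → Prop)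
    (hR : ∀ e f, R e f → e ∈ A ∧ f ∉ A) :
    ∃ (C : Finset E) (p : E → E), (∀ e f, R e f → e ∈ C ∨ f ∈ C) ∧ (∀ x ∈ C, p x ∉ C) ∧
      Set.InjOn p C ∧ ∀ x ∈ C, R x (p x) ∨ R (p x) x := by
  obtain ⟨C, hC, hmin⟩ := Finset.exists_min_image
    (Finset.univ.filter fun C : Finset E => ∀ e f, R e f → e ∈ C ∨ f ∈ C) Finset.card
    ⟨Finset.univ, by simp⟩
  simp only [Finset.mem_filter, Finset.mem_univ, true_and] at hC hmin
  -- Hall's condition for the part of `C` selected by `P`: replacing a subset by its neighbours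
  -- outside `C` again gives a cover, which cannot be smaller. It is applied to each side of the
  -- bipartition; the two matchings have images on opposite sides.
  have hhall : ∀ (P : E → Prop) (N : E → Finset E), (∀ x ∈ C, ∀ y ∈ N x, y ∉ C) →
      (∀ x ∈ C, P x → ∀ e f, R e f → e = x ∨ f = x → (e ∈ C ∧ ¬ P e) ∨ (f ∈ C ∧ ¬ P f) ∨
        e ∈ N x ∨ f ∈ N x) →
      ∃ q : {x // x ∈ C ∧ P x} → E, Function.Injective q ∧ ∀ x : {x // x ∈ C ∧ P x}, q x ∈ N x := by
    intro P N hN hP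
    refine (Finset.all_card_le_biUnion_card_iff_exists_injective
      fun x : {x // x ∈ C ∧ P x} => N x).1 fun s => ?_
    set S : Finset E := s.image Subtype.val with hS
    have hSC : S ⊆ C := by
      intro x hx
      obtain ⟨y, -, rfl⟩ := Finset.mem_image.1 hx
      exact y.2.1
    have hcover := hmin ((C \ S) ∪ s.biUnion fun x => N x) fun e f hef => by
      have hS' : ∀ z, z ∈ C → ¬ P z → z ∈ (C \ S) ∪ s.biUnion fun x => N x := fun z hz hPz =>
        Finset.mem_union_left _ (Finset.mem_sdiff.2 ⟨hz, fun hzS => by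
          obtain ⟨y, -, rfl⟩ := Finset.mem_image.1 hzS
          exact hPz y.2.2⟩)
      have haux : ∀ z, z ∈ C → (e = z ∨ f = z) →
          e ∈ (C \ S) ∪ s.biUnion (fun x => N x) ∨ f ∈ (C \ S) ∪ s.biUnion fun x => N x := by
        intro z hz hzef
        by_cases hzS : z ∈ S
        · obtain ⟨y, hy, rfl⟩ := Finset.mem_image.1 hzS
          have hNy : N y ⊆ (C \ S) ∪ s.biUnion fun x => N x := fun t ht =>
            Finset.mem_union_right _ (Finset.mem_biUnion.2 ⟨y, hy, ht⟩)
          rcases hP y y.2.1 y.2.2 e f hef hzef with h | h | h | h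
          exacts [.inl (hS' _ h.1 h.2), .inr (hS' _ h.1 h.2), .inl (hNy h), .inr (hNy h)]
        · have : z ∈ (C \ S) ∪ s.biUnion fun x => N x :=
            Finset.mem_union_left _ (Finset.mem_sdiff.2 ⟨hz, hzS⟩)
          rcases hzef with rfl | rfl
          exacts [.inl this, .inr this]
      rcases hC e f hef with h | h
      exacts [haux e h (.inl rfl), haux f h (.inr rfl)]
    have h1 := hcover.trans (Finset.card_union_le _ _)
    rw [Finset.card_sdiff_of_subset hSC] at h1
    have h2 : S.card = s.card := Finset.card_image_of_injective _ Subtype.val_injective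
    have h3 := Finset.card_le_card hSC
    omega
  obtain ⟨q, hq, hqN⟩ := hhall (· ∈ A) (fun x => Finset.univ.filter fun f => R x f ∧ f ∉ C)
    (by simp) (by
      rintro x - hx e f hef (rfl | rfl)
      · by_cases hf : f ∈ C
        · exact .inr (.inl ⟨hf, (hR _ _ hef).2⟩)
        · exact .inr (.inr (.inr (by simp [hef, hf])))
      · exact absurd hx (hR _ _ hef).2)
  obtain ⟨q', hq', hqN'⟩ := hhall (· ∉ A) (fun x => Finset.univ.filter fun e => R e x ∧ e ∉ C)
    (by simp) (by
      rintro x - hx e f hef (rfl | rfl)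
      · exact absurd (hR _ _ hef).1 hx
      · by_cases he : e ∈ C
        · exact .inl ⟨he, fun h => h (hR _ _ hef).1⟩
        · exact .inr (.inr (.inl (by simp [hef, he]))))
  simp only [Finset.mem_filter, Finset.mem_univ, true_and] at hqN hqN'
  refine ⟨C, fun x => if h : x ∈ C ∧ x ∈ A then q ⟨x, h⟩ else
    if h : x ∈ C ∧ x ∉ A then q' ⟨x, h⟩ else x, hC, fun x hx => ?_, ?_, fun x hx => ?_⟩
  · by_cases hA : x ∈ A
    · simpa [hx, hA] using (hqN ⟨x, hx, hA⟩).2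
    · simpa [hx, hA] using (hqN' ⟨x, hx, hA⟩).2
  · intro x hx y hy hxy
    rw [Finset.mem_coe] at hx hy
    by_cases hA : x ∈ A <;> by_cases hB : y ∈ A <;> simp only [hx, hy, hA, hB, and_self,
      not_true_eq_false, not_false_eq_true, and_false, dite_true, dite_false] at hxy
    · simpa using hq hxy
    · exact absurd (hR _ _ (hqN' ⟨y, hy, hB⟩).1).1 (hxy ▸ (hR _ _ (hqN ⟨x, hx, hA⟩).1).2)
    · exact absurd (hR _ _ (hqN' ⟨x, hx, hA⟩).1).1 (hxy ▸ (hR _ _ (hqN ⟨y, hy, hB⟩).1).2)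
    · simpa using hq' hxy
  · by_cases hA : x ∈ A
    · simpa [hx, hA] using Or.inl (hqN ⟨x, hx, hA⟩).1
    · simpa [hx, hA] using Or.inr (hqN' ⟨x, hx, hA⟩).1

end Finset

/-! ### Querying the cover. -/

namespace MSTInstance

variable {V : Type u} {E : Type v} {I : MSTInstance V E} {T : Finset E}

variable (I) in
/-- The pairs whose order is not known in advance: `e` lies on the cycle that `f` closes with `T`,
and their intervals overlap. -/
def Overlaps (T : Finset E) (e f : E) : Prop := I.Exchangeable T e f ∧ I.lo f < I.hi e

variable (I) in
/-- The weight `x` of the edge `e` decides all comparisons with overlapping edges in favor of the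
tree `T`. -/
def Confirms (T : Finset E) (e : E) (x : ℝ) : Prop :=
  (∀ f, I.Overlaps T e f → x ≤ I.lo f) ∧ ∀ f, I.Overlaps T f e → I.hi f ≤ x

variable (I) in
open Classical in
/-- The query order: tree edges by decreasing upper limit, other edges by increasing lower limit. -/
noncomputable def queryKey (T : Finset E) (e : E) : ℝ := if e ∈ T then -I.hi e else I.lo e

/-- Correct predictions confirm the limit tree of a prediction mandatory free instance. -/
lemma PredictionMandatoryFree.confirms_pred [Finite V] [Finite E] (h : I.PredictionMandatoryFree)
    (hL : I.LowerOptimal T) (hU : I.UpperOptimal T) (x : E) : I.Confirms T x (I.pred x) := by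
  have := Fintype.ofFinite E
  classical
  have hpred : I.IsRealization I.pred := I.pred_mem
  constructor <;> intro y hy
  -- If the predicted weight of `x` exceeded the least lower limit among its exchange partners, a
  -- feasible set avoiding that partner `f` would produce a partner with a still smaller lower
  -- limit.
  · obtain ⟨f, hf, hmin⟩ := Finset.exists_min_image
      (Finset.univ.filter fun f => I.Exchangeable T x f) I.lo ⟨y, by simpa using hy.1⟩
    simp only [Finset.mem_filter, Finset.mem_univ, true_and] at hf hmin
    refine le_trans ?_ (hmin y hy.1)
    by_contra! hlt
    obtain ⟨F, ⟨T', hF⟩, hfF⟩ : ∃ F, I.IsFeasible I.pred F ∧ f ∉ F := by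
      simpa [IsMandatory] using h f
    obtain ⟨g, hg, -, -, hg'⟩ := hU.exists_weight_le_lo hpred hF hf
      (hlt.trans_le (le_hi_of_mem (hpred x))) hfF (.inr hlt)
    exact hg'.not_ge (hmin g hg)
  · obtain ⟨e, he, hmax⟩ := Finset.exists_max_image
      (Finset.univ.filter fun e => I.Exchangeable T e x) I.hi ⟨y, by simpa using hy.1⟩
    simp only [Finset.mem_filter, Finset.mem_univ, true_and] at he hmax
    refine (hmax y hy.1).trans ?_
    by_contra! hlt
    obtain ⟨F, ⟨T', hF⟩, heF⟩ : ∃ F, I.IsFeasible I.pred F ∧ e ∉ F := by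
      simpa [IsMandatory] using h e
    obtain ⟨g, hg, -, -, hg'⟩ := hL.exists_hi_le_weight hpred hF he
      ((lo_le_of_mem (hpred x)).trans_lt hlt) heF (.inr hlt)
    exact hg'.not_ge (hmax g hg)

section Cover

variable {C : Finset E} {w : E → ℝ}

/-- Each overlapping pair has a queried end whose weight lies beyond the whole interval of the other
end. -/
lemma certifies_of_cover_confirms [Finite V] (hT : I.IsSpanningTree T)
    (hC : ∀ e f, I.Overlaps T e f → e ∈ C ∨ f ∈ C) (h : ∀ x ∈ C, I.Confirms T x (w x)) :
    I.Certifies w C T := by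
  refine certifies_of_exchangeable_le hT fun w' hw' hw e f hef => ?_
  by_cases hlt : I.lo f < I.hi e
  · rcases hC e f ⟨hef, hlt⟩ with he | hf
    · rw [hw e he]
      exact ((h e he).1 f ⟨hef, hlt⟩).trans (lo_le_of_mem (hw' f))
    · rw [hw f hf]
      exact (le_hi_of_mem (hw' e)).trans ((h f hf).2 e ⟨hef, hlt⟩)
  · exact (le_hi_of_mem (hw' e)).trans ((not_lt.1 hlt).trans (lo_le_of_mem (hw' f)))

/-- A cover edge and an overlapping edge outside the cover meet every feasible query set if the
preceding cover edges confirm the limit tree. -/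
lemma mem_or_mem_of_confirms [Finite V] (hL : I.LowerOptimal T) (hU : I.UpperOptimal T)
    (hC : ∀ e f, I.Overlaps T e f → e ∈ C ∨ f ∈ C) (hw : I.IsRealization w) {x y : E}
    (hxy : I.Overlaps T x y ∨ I.Overlaps T y x) (hy : y ∉ C)
    (h : ∀ z ∈ C, I.queryKey T z < I.queryKey T x → I.Confirms T z (w z)) {F : Finset E}
    (hF : I.IsFeasible w F) : x ∈ F ∨ y ∈ F := by
  obtain ⟨T', hF⟩ := hF
  by_contra! hnot
  rcases hxy with hxy | hxy
  · obtain ⟨g, hg, hlt, hle, hlt'⟩ :=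
      hL.exists_hi_le_weight hw hF hxy.1 hxy.2 hnot.1 (.inl hnot.2)
    -- The edge `g` overlaps `y`, which is outside the cover, so `g` is in it; its larger upper
    -- limit places it before `x`. Only predecessors on the side of `x` matter.
    have h1 := (h g ((hC g y ⟨hg, hlt⟩).resolve_right hy) (by
      simpa [queryKey, hg.1, hxy.1.1] using hlt')).1 y ⟨hg, hlt⟩
    exact (hxy.2.trans_le (hle.trans h1)).false
  · obtain ⟨g, hg, hlt, hle, hlt'⟩ :=
      hU.exists_weight_le_lo hw hF hxy.1 hxy.2 hnot.1 (.inl hnot.2)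
    have h1 := (h g ((hC y g ⟨hg, hlt⟩).resolve_left hy) (by
      simpa [queryKey, hg.2.1, hxy.1.2.1] using hlt')).2 y ⟨hg, hlt⟩
    exact (hxy.2.trans_le (h1.trans hle)).false

end Cover

open Classical in
-- The pairs `x`, `p x` are disjoint, so choosing a member of `F` from each is injective.
lemma card_le_card_inter_of_mem_or_mem {C D F : Finset E} {p : E → E} (hp : ∀ x ∈ C, p x ∉ C)
    (hinj : Set.InjOn p C) (hD : D ⊆ C) (h : ∀ x ∈ D, x ∈ F ∨ p x ∈ F) :
    D.card ≤ (F ∩ (D ∪ D.image p)).card := by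
  refine Finset.card_le_card_of_injOn (fun x => if x ∈ F then x else p x) ?_ ?_
  · intro x hx
    have hx' : x ∈ D := hx
    by_cases hxF : x ∈ F
    · simp [hxF, hx']
    · have := (h x hx').resolve_left hxF
      simp only [hxF, if_false, Finset.coe_inter, Set.mem_inter_iff, Finset.mem_coe, this,
        true_and]
      exact Finset.mem_union_right _ (Finset.mem_image_of_mem _ hx')
  · intro x hx y hy hxy
    have hx' := hD hx
    have hy' := hD hy
    simp only at hxy
    split_ifs at hxy with h1 h2 h2
    · exact hxy
    · exact absurd (hxy ▸ hx') (hp y hy')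
    · exact absurd (hxy ▸ hy') (hp x hx')
    · exact hinj hx' hy' hxy

open Classical in
/-- Continuing to query a matched vertex cover after the edges of an initial part `D` have confirmed
the limit tree: if all of them do, only the cover is queried; otherwise the partners of the edges
queried so far are queried as well, before a robust continuation. -/
lemma exists_cover_strategy [Finite V] [Finite E] (hL : I.LowerOptimal T) (hU : I.UpperOptimal T)
    {C : Finset E} {p : E → E} (hC : ∀ e f, I.Overlaps T e f → e ∈ C ∨ f ∈ C)
    (hp : ∀ x ∈ C, p x ∉ C) (hinj : Set.InjOn p C)
    (hpair : ∀ x ∈ C, I.Overlaps T x (p x) ∨ I.Overlaps T (p x) x)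
    (D : Finset E) (hD : D ⊆ C)
    (hinit : ∀ x ∈ D, ∀ y ∈ C, I.queryKey T y < I.queryKey T x → y ∈ D) (r : E → ℝ) :
    ∃ S : QueryStrategy E, ∀ w, I.IsRealization w → (∀ e ∈ D, r e = w e) →
      (∀ x ∈ D, I.Confirms T x (w x)) →
        I.Certifies w (D ∪ (S.queries w).toFinset) (S.result w) ∧
        (∀ F, I.IsFeasible w F → D.card + (S.queries w).length ≤ 2 * F.card) ∧
        ((∀ x ∈ C, I.Confirms T x (w x)) → D.card + (S.queries w).length = C.card) := by
  induction hn : (C \ D).card generalizing D r with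
  | zero =>
    have hDC : D = C := hD.antisymm (by
      rwa [Finset.card_eq_zero, Finset.sdiff_eq_empty_iff_subset] at hn)
    subst hDC
    refine ⟨.output T, fun w hw _ hgood => ⟨?_, fun F hF => ?_, fun _ => by
      simp [QueryStrategy.queries]⟩⟩
    · simpa [QueryStrategy.queries, QueryStrategy.result] using
        certifies_of_cover_confirms hL.isSpanningTree hC hgood
    · have h1 := card_le_card_inter_of_mem_or_mem (F := F) hp hinj le_rfl fun x hx =>
        mem_or_mem_of_confirms hL hU hC hw (hpair x hx) (hp x hx) (fun z hz _ => hgood z hz) hF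
      have h2 := Finset.card_le_card (Finset.inter_subset_left (s₁ := F) (s₂ := D ∪ D.image p))
      simp only [QueryStrategy.queries, List.length_nil]
      omega
  | succ n ih =>
    obtain ⟨x, hx, hmin⟩ := Finset.exists_min_image (C \ D) (I.queryKey T)
      (Finset.card_pos.1 (by omega))
    obtain ⟨hxC, hxD⟩ := Finset.mem_sdiff.1 hx
    have hD' : insert x D ⊆ C := Finset.insert_subset hxC hD
    have hprec : ∀ y ∈ C, I.queryKey T y < I.queryKey T x → y ∈ D := fun y hy hlt => by
      by_contra hyD
      exact hlt.not_ge (hmin y (Finset.mem_sdiff.2 ⟨hy, hyD⟩))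
    have hinit' : ∀ z ∈ insert x D, ∀ y ∈ C, I.queryKey T y < I.queryKey T z → y ∈ insert x D := by
      intro z hz y hy hlt
      refine Finset.mem_insert_of_mem ?_
      rcases Finset.mem_insert.1 hz with rfl | hz
      exacts [hprec y hy hlt, hinit z hz y hy hlt]
    have hcard : (insert x D).card = D.card + 1 := Finset.card_insert_of_notMem hxD
    choose S hS using fun r' => ih (insert x D) hD' hinit' r' (by
      rw [Finset.card_sdiff_of_subset hD', hcard]
      rw [Finset.card_sdiff_of_subset hD] at hn
      omega)
    choose R hR using exists_robust_continuation ⟨T, hL.isSpanningTree⟩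
      (insert x D ∪ (insert x D).image p)
    refine ⟨.query x fun v => if I.Confirms T x v then S (Function.update r x v) else
      .queryAll ((insert x D).image p).toList (Function.update r x v) R, fun w hw hr hgood => ?_⟩
    have hr' : ∀ e ∈ insert x D, Function.update r x (w x) e = w e := by
      intro e he
      by_cases hex : e = x
      · subst hex; simp
      · simpa [hex] using hr e (Finset.mem_of_mem_insert_of_ne he hex)
    simp only [QueryStrategy.queries, QueryStrategy.result]
    by_cases hxw : I.Confirms T x (w x)
    · rw [if_pos hxw]
      obtain ⟨h1, h2, h3⟩ := hS _ w hw hr' (by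
        intro z hz
        rcases Finset.mem_insert.1 hz with rfl | hz
        exacts [hxw, hgood z hz])
      refine ⟨?_, fun F hF => ?_, fun hall => ?_⟩
      · simpa [List.toFinset_cons, Finset.union_insert] using h1
      · have := h2 F hF
        simp only [List.length_cons]
        omega
      · have := h3 hall
        simp only [List.length_cons]
        omega
    · rw [if_neg hxw]
      obtain ⟨r', h1, h2, h3⟩ := QueryStrategy.queryAll_run R w
        ((insert x D).image p).toList (Function.update r x (w x))
      obtain ⟨h4, h5⟩ := hR r' w hw fun e he => h1 e (by
        rcases Finset.mem_union.1 he with he | he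
        · exact .inr (hr' e he)
        · exact .inl (Finset.mem_toList.2 he))
      rw [h2, h3]
      refine ⟨?_, fun F hF => ?_, fun hall => absurd (hall x hxC) hxw⟩
      · refine h4.mono ?_
        rw [List.toFinset_cons, List.toFinset_append, Finset.toList_toFinset, Finset.union_insert,
          Finset.insert_union, Finset.insert_union, Finset.union_assoc]
      -- The failing edge `x` counts as well: its pair only requires the edges before it to confirm
      -- `T`. Inside the pairs the cost is at most `2 * (insert x D).card`, outside them at most
      -- twice the rest of `F`.
      · have h6 := card_le_card_inter_of_mem_or_mem (F := F) hp hinj hD' fun z hz =>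
          mem_or_mem_of_confirms hL hU hC hw (hpair z (hD' hz)) (hp z (hD' hz))
            (fun y hy hlt => hgood y (by
              rcases Finset.mem_insert.1 hz with rfl | hz
              exacts [hprec y hy hlt, hinit z hz y hy hlt])) hF
        have h7 := h5 F hF
        have h8 := Finset.card_sdiff_add_card_inter F (insert x D ∪ (insert x D).image p)
        have h9 : ((insert x D).image p).card ≤ _ := Finset.card_image_le
        rw [List.length_cons, List.length_append, Finset.length_toList]
        omega

/-- A consistent and robust strategy for one instance. -/
lemma exists_consistent_robust_strategy [Finite V] [Finite E] (h : I.PredictionMandatoryFree)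
    (hT : I.UniqueLimitTrees) :
    ∃ S : QueryStrategy E, S.IsConsistent I 1 ∧ S.IsRobust I 2 := by
  have := Fintype.ofFinite E
  obtain ⟨T, ⟨hL, -⟩, hU, -⟩ := hT
  replace hL := hL.lowerOptimal
  replace hU := hU.upperOptimal
  obtain ⟨C, p, hC, hp, hinj, hpair⟩ := Finset.exists_matched_vertexCover T (I.Overlaps T)
    fun e f hef => ⟨hef.1.1, hef.1.2.1⟩
  obtain ⟨S, hS⟩ := exists_cover_strategy hL hU hC hp hinj hpair ∅ (by simp) (by simp) I.pred
  refine ⟨S, ?_, fun w hw => ?_⟩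
  · have hgood := h.confirms_pred hL hU
    obtain ⟨h1, -, h3⟩ := hS I.pred I.pred_mem (by simp) (by simp)
    refine ⟨by simpa using h1, fun OPT hOPT => ?_⟩
    classical
    have h4 := card_le_card_inter_of_mem_or_mem (F := OPT) hp hinj le_rfl fun x hx =>
      mem_or_mem_of_confirms hL hU hC (w := I.pred) I.pred_mem (hpair x hx) (hp x hx)
        (fun z _ _ => hgood z) hOPT.1
    have h5 := Finset.card_le_card (Finset.inter_subset_left (s₁ := OPT) (s₂ := C ∪ C.image p))
    have h6 := h3 fun x _ => hgood x
    rw [Finset.card_empty, zero_add] at h6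
    rw [one_mul, Nat.cast_le, h6]
    exact h4.trans h5
  · obtain ⟨h1, h2, -⟩ := hS w hw (by simp) (by simp)
    refine ⟨by simpa using h1, fun OPT hOPT => ?_⟩
    have := h2 OPT hOPT.1
    rw [Finset.card_empty, zero_add] at this
    exact_mod_cast this

end MSTInstance

theorem mainTheorem5 :
    ∃ A : QueryAlgorithm.{u, v},
      ∀ (V : Type u) (E : Type v) [Finite V] [Finite E] (I : MSTInstance V E),
        I.PredictionMandatoryFree → I.UniqueLimitTrees →
          (A V E I).IsConsistent I 1 ∧ (A V E I).IsRobust I 2 := by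
  classical
  -- A strategy is chosen for each instance separately; `.output ∅` is a default for instances
  -- without a suitable one.
  refine ⟨fun V E _ _ I => if h : ∃ S : QueryStrategy E, S.IsConsistent I 1 ∧ S.IsRobust I 2 then
    h.choose else .output ∅, fun V E _ _ I hfree huniq => ?_⟩
  have h := I.exists_consistent_robust_strategy hfree huniq
  simp only [h, dif_pos]
  exact h.choose_spec
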